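/- Let $G=(S,T,E)$ be a finite bipartite graph with vertex set $V=S\sqcup T$. For a matching $M$ of $G$ (possibly empty), let $V(M)\subseteq V$ be the set of vertices covered by $M$, and let $B(M)=V(M)\,\Delta\, S$, where $\Delta$ denotes the symmetric difference. For families $\mathcal{A},\mathcal{B}$ of subsets of $V$ put \[\mathcal{A}\,\square\,\mathcal{B}=\{A\cup B : A\in\mathcal{A},\ B\in\mathcal{B},\ A\cap B=\emptyset\}.\] Let $M$ be a uniformly random matching of $G$, that is, chosen uniformly from the set of all matchings of $G$. Then for any two upward closed families $\mathcal{A},\mathcal{B}$ of subsets of $V$, \[\mathbb{P}(B(M)\in\mathcal{A}\,\square\,\mathcal{B})\le\mathbb{P}(B(M)\in\mathcal{A})\,\mathbb{P}(B(M)\in\mathcal{B}).\] -/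

import Mathlib

open scoped symmDiff

/-- The matchings of `G`. In Mathlib a matching is a subgraph `M` in which every vertex of
`M.verts` is incident with exactly one edge of `M`; so `M` is determined by its edges and
`M.verts` is the set of vertices covered by `M`. -/
abbrev Matching {V : Type*} (G : SimpleGraph V) : Type _ := {M : G.Subgraph // M.IsMatching}

instance Matching.instNonempty {V : Type*} (G : SimpleGraph V) : Nonempty (Matching G) :=
  ⟨⟨⊥, fun _ hv => absurd hv (Set.notMem_empty _)⟩⟩

/-- The law of a uniform random matching of a finite graph. -/
noncomputable def uniformMatching {V : Type*} [Finite V] (G : SimpleGraph V) :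
    PMF (Matching G) :=
  letI := Fintype.ofFinite (Matching G)
  PMF.uniformOfFintype (Matching G)

/-- `B(M) = V(M) ∆ S`. -/
def matchingSet {V : Type*} {G : SimpleGraph V} (S : Set V) (M : Matching G) : Set V :=
  M.1.verts ∆ S

/-- The disjoint occurrence `𝒜 □ ℬ` of two (increasing) events. -/
def disjointOccurrence {V : Type*} (𝒜 ℬ : Set (Set V)) : Set (Set V) :=
  {C | ∃ A ∈ 𝒜, ∃ B ∈ ℬ, A ∩ B = ∅ ∧ C = A ∪ B}

/-!
Let `M`, `N` be two matchings. In each component of `M ∪ N`, a path or a cycle, at most one vertex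
lies in `B(M) \ B(N)`: directing the edges of `M` into `S` and those of `N` out of `S` gives every
vertex at most one incoming arc, the vertices of `B(M) \ B(N)` have none, and a component contains
at most one such source. Exchange `M` and `N` on an arbitrary set of components, encoded by a point
`ω` of a cube. If the first of the two resulting matchings has its set in `𝒜 □ ℬ`, with witnesses
`A` and `B`, then no component is needed for both `A` and `B`, so `ω` lies in a subcube forcing `𝒜`
and in one forcing `ℬ` which fix disjoint sets of coordinates. By Reimer's butterfly theorem there
are at most as many such `ω` as there are `ω` whose first matching is in `𝒜` and whose second one,
belonging to the antipode of `ω`, is in `ℬ`. As every exchange permutes the pairs of matchings,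
averaging over all pairs yields the inequality.

The butterfly theorem is linear algebra. To each point `x` of the cube and each set `s` of
coordinates belongs an integer vector `y` such that `y` and `K y`, for a positive definite `K`, are
supported on the antipode of the subcube through `x` fixing `sᶜ` and on the subcube through `x`
fixing `s`. Modulo 2, `y` is the indicator of the antipode of `x`, whence linear independence.
-/

section LinearIndependence

open Matrix

variable {R κ n : Type*}

theorem linearIndependent_of_map_submatrix_eq_one {k : Type*} [CommRing R] [IsDomain R]
    [CommRing k] [Nontrivial k] [Finite κ] [DecidableEq κ] (f : R →+* k) {v : κ → n → R}
    (e : κ → n) (h : ((Matrix.of v).submatrix id e).map f = 1) : LinearIndependent R v := by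
  have := Fintype.ofFinite κ
  have hdet : ((Matrix.of v).submatrix id e).det ≠ 0 := fun h0 => by
    simpa [RingHom.mapMatrix_apply, h, h0] using f.map_det ((Matrix.of v).submatrix id e)
  exact .of_comp (LinearMap.funLeft R R e) (linearIndependent_rows_of_det_ne_zero hdet)

theorem support_subset_of_mem_span_range [Semiring R] {v : κ → n → R} {B : Set n}
    (hB : ∀ x, Function.support (v x) ⊆ B) {w : n → R} (hw : w ∈ Submodule.span R (Set.range v)) :
    Function.support w ⊆ B := by
  induction hw using Submodule.span_induction with
  | mem _ h => obtain ⟨x, rfl⟩ := h; exact hB x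
  | zero => simp
  | add y z _ _ hy hz => exact (Function.support_add y z).trans (Set.union_subset hy hz)
  | smul a y _ hy => exact (Function.support_const_smul_subset a y).trans hy

theorem card_le_ncard_inter_of_posDef [CommRing R] [PartialOrder R] [StarRing R] [Nontrivial R]
    [Finite κ] [Fintype n] {K : Matrix n n R} (hK : K.PosDef) {v : κ → n → R}
    (hv : LinearIndependent R v) {A B : Set n}
    (hA : ∀ x, Function.support (K *ᵥ v x) ⊆ A) (hB : ∀ x, Function.support (v x) ⊆ B) :
    Nat.card κ ≤ (A ∩ B).ncard := by
  classical
  have := Fintype.ofFinite κ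
  let φ : (n → R) →ₗ[R] (↥(A ∩ B) → R) := LinearMap.funLeft R R Subtype.val ∘ₗ K.mulVecLin
  have hφ : LinearIndependent R (φ ∘ v) := hv.map <| Submodule.disjoint_def.2 fun w hw hφw => by
    have hKw : K *ᵥ w ∈ Submodule.span R (Set.range fun x => K *ᵥ v x) := by
      simpa [Submodule.map_span, ← Set.range_comp, Function.comp_def] using
        Submodule.mem_map_of_mem (f := K.mulVecLin) hw
    -- Each summand vanishes: off `A` by `K w`, off `B` by `w`, on `A ∩ B` since `φ w = 0`.
    have hquad : star w ⬝ᵥ (K *ᵥ w) = 0 := Finset.sum_eq_zero fun z _ => by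
      by_contra hne
      have hz : z ∈ A ∩ B := ⟨support_subset_of_mem_span_range hA hKw (right_ne_zero_of_mul hne),
        support_subset_of_mem_span_range hB hw (star_ne_zero.1 (left_ne_zero_of_mul hne))⟩
      exact right_ne_zero_of_mul hne (congrFun hφw ⟨z, hz⟩)
    by_contra hw_ne
    exact (hK.dotProduct_mulVec_pos hw_ne).ne' hquad
  rw [← Nat.card_coe_set_eq, Nat.card_eq_fintype_card, Nat.card_eq_fintype_card,
    ← Module.finrank_fintype_fun_eq_card R (η := ↥(A ∩ B))]
  exact hφ.fintype_card_le_finrank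

end LinearIndependence

section Reimer

open Matrix

theorem sum_prod_mul_prod {ι R α : Type*} [CommSemiring R] [Fintype ι] [DecidableEq ι] [Fintype α]
    (f g : ι → α → R) :
    ∑ w : ι → α, (∏ i, f i (w i)) * ∏ i, g i (w i) = ∏ i, ∑ a, f i a * g i a := by
  simp only [← Finset.prod_mul_distrib, Fintype.prod_sum]

variable (ι : Type*) [Fintype ι]

/-- The incidence matrix of points and subcubes of the discrete cube. A subcube is encoded as
`y : ι → Option Bool`, where `y i = none` leaves the coordinate `i` free. -/
def subcubeIncidence : Matrix (ι → Bool) (ι → Option Bool) ℤ :=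
  .of fun z y => ∏ i, if y i = none ∨ y i = some (z i) then 1 else 0

/-- The tensor power of `!![2, 1; 1, 2]`; its entry at `z, w` counts the subcubes containing both
`z` and `w`. -/
def subcubeGram : Matrix (ι → Bool) (ι → Bool) ℤ :=
  .of fun z w => ∏ i, if z i = w i then 2 else 1

theorem subcubeIncidence_some_comp (z w : ι → Bool) :
    subcubeIncidence ι z (some ∘ w) = if z = w then 1 else 0 := by
  simp [subcubeIncidence, Finset.prod_ite_zero, funext_iff, eq_comm]

theorem vecMul_subcubeIncidence_injective [DecidableEq ι] :
    Function.Injective (subcubeIncidence ι).vecMul := fun v v' h => by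
  ext w
  simpa [vecMul, dotProduct, subcubeIncidence_some_comp] using congrFun h (some ∘ w)

theorem subcubeIncidence_mul_conjTranspose [DecidableEq ι] :
    subcubeIncidence ι * (subcubeIncidence ι)ᴴ = subcubeGram ι := by
  ext z w
  simp only [mul_apply, conjTranspose_apply, star_trivial, subcubeIncidence, subcubeGram, of_apply]
  rw [sum_prod_mul_prod (fun i b => if b = none ∨ b = some (z i) then (1 : ℤ) else 0)
    fun i b => if b = none ∨ b = some (w i) then 1 else 0]
  refine Finset.prod_congr rfl fun i _ => ?_
  cases z i <;> cases w i <;> rfl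

theorem posDef_subcubeGram : (subcubeGram ι).PosDef := by
  classical
  rw [← subcubeIncidence_mul_conjTranspose]
  exact .mul_conjTranspose_self _ (vecMul_subcubeIncidence_injective ι)

variable {ι}

open Classical in
/-- A vector whose support avoids the points agreeing with `x` somewhere outside `s`, while its
image under `subcubeGram` is supported on the points agreeing with `x` on `s`. The factor for
`i ∈ s` is a multiple of a column of the inverse of `!![2, 1; 1, 2]`. -/
noncomputable def cylinderVector (s : Set ι) (x w : ι → Bool) : ℤ :=
  ∏ i, if i ∈ s then (if w i = x i then 2 else -1) else (if w i = x i then 0 else 1)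

theorem support_cylinderVector_subset (s : Set ι) (x : ι → Bool) :
    Function.support (cylinderVector s x) ⊆ {w | sᶜ.EqOn wᶜ x} := fun w hw i hi => by
  have hne := Finset.prod_ne_zero_iff.1 hw i (Finset.mem_univ i)
  simpa [show i ∉ s from hi, Bool.eq_not] using hne

theorem support_subcubeGram_mulVec_cylinderVector_subset [DecidableEq ι] (s : Set ι)
    (x : ι → Bool) :
    Function.support (subcubeGram ι *ᵥ cylinderVector s x) ⊆ {z | s.EqOn z x} := fun z hz i hi => by
  classical
  simp only [Function.mem_support, mulVec, dotProduct, subcubeGram, cylinderVector, of_apply] at hz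
  rw [sum_prod_mul_prod (fun i b => if z i = b then (2 : ℤ) else 1) fun i b =>
    if i ∈ s then (if b = x i then 2 else -1) else (if b = x i then 0 else 1)] at hz
  have hne := Finset.prod_ne_zero_iff.1 hz i (Finset.mem_univ i)
  cases hzi : z i <;> cases hxi : x i <;> simp [hi, hzi, hxi] at hne ⊢

theorem cylinderVector_cast_zmod_two (s : Set ι) (x w : ι → Bool) :
    (cylinderVector s x w : ZMod 2) = if x = wᶜ then 1 else 0 := by
  classical
  have hfactor (i : ι) : ((if i ∈ s then (if w i = x i then 2 else -1) else
      (if w i = x i then 0 else 1) : ℤ) : ZMod 2) = if x i = wᶜ i then 1 else 0 := by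
    by_cases hi : i ∈ s <;> cases hw : w i <;> cases hx : x i <;> simp [hi, hw] <;> rfl
  simp only [cylinderVector, Int.cast_prod, hfactor, Finset.prod_ite_zero, Finset.mem_univ,
    forall_const, Finset.prod_const_one, funext_iff]

theorem linearIndependent_cylinderVector (s : (ι → Bool) → Set ι) :
    LinearIndependent ℤ fun x => cylinderVector (s x) x := by
  classical
  refine linearIndependent_of_map_submatrix_eq_one (Int.castRingHom (ZMod 2)) compl ?_
  ext x w
  simp [cylinderVector_cast_zmod_two, one_apply]

/-- **Reimer's butterfly theorem**. -/
theorem ncard_le_ncard_inter_preimage_compl {ι : Type*} [Finite ι] {X A B : Set (ι → Bool)}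
    (hX : ∀ x ∈ X, ∃ s : Set ι, (∀ z, s.EqOn z x → z ∈ A) ∧ ∀ z, sᶜ.EqOn z x → z ∈ B) :
    X.ncard ≤ (A ∩ compl ⁻¹' B).ncard := by
  classical
  have := Fintype.ofFinite ι
  choose! s hA hB using hX
  exact card_le_ncard_inter_of_posDef (posDef_subcubeGram ι)
    ((linearIndependent_cylinderVector s).comp (Subtype.val : X → _) Subtype.val_injective)
    (fun x => (support_subcubeGram_mulVec_cylinderVector_subset (s x) x.1).trans (hA x x.2))
    fun x => (support_cylinderVector_subset (s x) x.1).trans fun w => hB x x.2 wᶜ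

end Reimer

section MixSet

variable {V κ : Type*}

/-- The set that follows `C` on the fibres of `ρ` selected by `ω` and `D` on the other fibres. -/
def mixSet (ρ : V → κ) (ω : κ → Bool) (C D : Set V) : Set V := {u | ω (ρ u)}.ite C D

variable {ρ : V → κ} {ω ω' : κ → Bool} {C D : Set V} {u : V}

theorem mem_mixSet : u ∈ mixSet ρ ω C D ↔ if ω (ρ u) then u ∈ C else u ∈ D := by
  cases h : ω (ρ u) <;> simp [mixSet, Set.ite, h]

theorem mem_mixSet_of_mem_inter (hu : u ∈ C ∩ D) : u ∈ mixSet ρ ω C D :=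
  Set.inter_subset_ite _ _ _ hu

theorem mem_mixSet_congr (h : ω' (ρ u) = ω (ρ u)) : u ∈ mixSet ρ ω' C D ↔ u ∈ mixSet ρ ω C D := by
  rw [mem_mixSet, mem_mixSet, h]

theorem injOn_mixSet_diff_inter (hCD : (C \ D).InjOn ρ) (hDC : (D \ C).InjOn ρ) (ω : κ → Bool) :
    (mixSet ρ ω C D \ (C ∩ D)).InjOn ρ := by
  rintro u ⟨hu, hu'⟩ v ⟨hv, hv'⟩ huv
  rw [mem_mixSet] at hu hv
  rw [← huv] at hv
  cases hω : ω (ρ u) <;> simp only [hω, if_true, if_false, Bool.false_eq_true] at hu hv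
  · exact hDC ⟨hu, fun h => hu' ⟨h, hu⟩⟩ ⟨hv, fun h => hv' ⟨h, hv⟩⟩ huv
  · exact hCD ⟨hu, fun h => hu' ⟨hu, h⟩⟩ ⟨hv, fun h => hv' ⟨hv, h⟩⟩ huv

theorem exists_eqOn_of_mixSet_mem_disjointOccurrence {𝒜 ℬ : Set (Set V)} (h𝒜 : IsUpperSet 𝒜)
    (hℬ : IsUpperSet ℬ) (hCD : (C \ D).InjOn ρ) (hDC : (D \ C).InjOn ρ)
    (hω : mixSet ρ ω C D ∈ disjointOccurrence 𝒜 ℬ) :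
    ∃ s : Set κ, (∀ ω', s.EqOn ω' ω → mixSet ρ ω' C D ∈ 𝒜) ∧
      ∀ ω', sᶜ.EqOn ω' ω → mixSet ρ ω' C D ∈ ℬ := by
  obtain ⟨A, hA, B, hB, hAB, hmix⟩ := hω
  -- The fibres on which `A` really depends; `B` cannot depend on them by injectivity.
  refine ⟨ρ '' (A \ (C ∩ D)), fun ω' hω' => h𝒜 (fun u hu => ?_) hA,
    fun ω' hω' => hℬ (fun u hu => ?_) hB⟩
  all_goals
    by_cases huCD : u ∈ C ∩ D
    · exact mem_mixSet_of_mem_inter huCD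
  · have hu_mix : u ∈ mixSet ρ ω C D := hmix ▸ Or.inl hu
    exact (mem_mixSet_congr (hω' ⟨u, ⟨hu, huCD⟩, rfl⟩)).2 hu_mix
  · have hu_mix : u ∈ mixSet ρ ω C D := hmix ▸ Or.inr hu
    refine (mem_mixSet_congr (hω' ?_)).2 hu_mix
    rintro ⟨v, ⟨hv, hvCD⟩, hvu⟩
    have hv_mix : v ∈ mixSet ρ ω C D := hmix ▸ Or.inl hv
    obtain rfl := injOn_mixSet_diff_inter hCD hDC ω ⟨hv_mix, hvCD⟩ ⟨hu_mix, huCD⟩ hvu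
    exact (Set.eq_empty_iff_forall_notMem.1 hAB) v ⟨hv, hu⟩

theorem ncard_mixSet_mem_disjointOccurrence_le [Finite κ] {𝒜 ℬ : Set (Set V)}
    (h𝒜 : IsUpperSet 𝒜) (hℬ : IsUpperSet ℬ) (hCD : (C \ D).InjOn ρ) (hDC : (D \ C).InjOn ρ) :
    {ω | mixSet ρ ω C D ∈ disjointOccurrence 𝒜 ℬ}.ncard ≤
      {ω | mixSet ρ ω C D ∈ 𝒜 ∧ mixSet ρ ωᶜ C D ∈ ℬ}.ncard :=
  ncard_le_ncard_inter_preimage_compl (A := {ω | mixSet ρ ω C D ∈ 𝒜})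
    (B := {ω | mixSet ρ ω C D ∈ ℬ}) fun _ =>
      exists_eqOn_of_mixSet_mem_disjointOccurrence h𝒜 hℬ hCD hDC

end MixSet

theorem ncard_le_ncard_of_forall_perm {α κ : Type*} [Finite α] [Finite κ] [Nonempty κ]
    (σ : κ → Equiv.Perm α) {P Q : Set α}
    (h : ∀ p, {ω | σ ω p ∈ P}.ncard ≤ {ω | σ ω p ∈ Q}.ncard) : P.ncard ≤ Q.ncard := by
  classical
  have := Fintype.ofFinite α
  have := Fintype.ofFinite κ
  have double_count (R : Set α) : ∑ p, {ω | σ ω p ∈ R}.ncard = Fintype.card κ * R.ncard := by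
    simp only [Set.ncard_eq_toFinset_card', Set.toFinset_ofPred, Finset.card_filter]
    rw [Finset.sum_comm]
    simp only [fun ω => Equiv.sum_comp (σ ω) fun p => if p ∈ R then 1 else 0]
    simp
  refine Nat.le_of_mul_le_mul_left ?_ (Fintype.card_pos (α := κ))
  rw [← double_count, ← double_count]
  exact Finset.sum_le_sum fun p _ => h p

theorem toOuterMeasure_uniformOfFintype_le_mul_iff {α : Type*} [Fintype α] [Nonempty α]
    (s t u : Set α) :
    (PMF.uniformOfFintype α).toOuterMeasure s ≤
        (PMF.uniformOfFintype α).toOuterMeasure t * (PMF.uniformOfFintype α).toOuterMeasure u ↔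
      s.ncard * Nat.card α ≤ t.ncard * u.ncard := by
  classical
  have hn : (Fintype.card α : ENNReal) ≠ 0 := by simp
  have hn' : (Fintype.card α : ENNReal) ≠ ⊤ := ENNReal.natCast_ne_top _
  simp only [PMF.toOuterMeasure_uniformOfFintype_apply, ← Nat.card_eq_fintype_card,
    Nat.card_coe_set_eq] at hn hn' ⊢
  rw [ENNReal.div_le_iff hn hn', mul_assoc, ENNReal.div_mul_cancel hn hn', mul_comm,
    ← mul_div_assoc, ENNReal.le_div_iff_mul_le (Or.inl hn) (Or.inl hn'),
    mul_comm (u.ncard : ENNReal)]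
  norm_cast

theorem eq_of_reflTransGen_symmGen_of_leftUnique {V : Type*} {r : V → V → Prop}
    (hr : Relator.LeftUnique r) {u v : V} (hu : ∀ a, ¬ r a u) (hv : ∀ a, ¬ r a v)
    (h : Relation.ReflTransGen (Relation.SymmGen r) u v) : u = v := by
  have hreach : Relation.ReflTransGen r u v := by
    clear hv
    induction h with
    | refl => exact .refl
    | tail _ hbc ih =>
      rcases hbc with hbc | hcb
      · exact ih.tail hbc
      · rcases ih.cases_tail with rfl | ⟨d, hud, hdb⟩
        · exact absurd hcb (hu _)
        · rwa [hr hcb hdb]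
  rcases hreach.cases_tail with rfl | ⟨d, _, hdv⟩
  · rfl
  · exact absurd hdv (hv d)

namespace Matching

variable {V : Type*} {G : SimpleGraph V}

theorem ext_adj {M N : Matching G} (h : ∀ a b, M.1.Adj a b ↔ N.1.Adj a b) : M = N := by
  have hadj : M.1.Adj = N.1.Adj := funext₂ fun a b => propext (h a b)
  refine Subtype.ext (SimpleGraph.Subgraph.ext ?_ hadj)
  rw [← M.2.support_eq_verts, ← N.2.support_eq_verts, SimpleGraph.Subgraph.support,
    SimpleGraph.Subgraph.support, hadj]

/-- The graph `M ∪ N` on all of `V`; its components are the cycles and paths along which the edges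
of `M` and `N` alternate (a common edge being a component of its own). -/
def unionGraph (M N : Matching G) : SimpleGraph V := M.1.spanningCoe ⊔ N.1.spanningCoe

theorem unionGraph_adj {M N : Matching G} {a b : V} :
    (M.unionGraph N).Adj a b ↔ M.1.Adj a b ∨ N.1.Adj a b := Iff.rfl

theorem unionGraph_comm (M N : Matching G) : M.unionGraph N = N.unionGraph M := sup_comm _ _

/-- The vertex set of the component of `a` in `M ∪ N`. Representing components by their vertex sets
gives them a type which does not depend on `M` and `N`. -/
def componentSupp (M N : Matching G) (a : V) : Set V :=
  ((M.unionGraph N).connectedComponentMk a).supp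

theorem componentSupp_comm (M N : Matching G) : M.componentSupp N = N.componentSupp M := by
  unfold componentSupp
  rw [unionGraph_comm]

theorem componentSupp_eq_iff {M N : Matching G} {a b : V} :
    M.componentSupp N a = M.componentSupp N b ↔ (M.unionGraph N).Reachable a b := by
  rw [componentSupp, componentSupp, SimpleGraph.ConnectedComponent.supp_inj,
    SimpleGraph.ConnectedComponent.eq]

section Orientation

variable {S T : Set V}

/-- The orientation of `M ∪ N` which directs the edges of `M` into `S` and those of `N` out of `S`,
where `S` is one side of a bipartition. -/
def alternatingArc (S : Set V) (M N : Matching G) (a b : V) : Prop :=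
  M.1.Adj a b ∧ b ∈ S ∨ N.1.Adj a b ∧ b ∉ S

theorem leftUnique_alternatingArc (S : Set V) (M N : Matching G) :
    Relator.LeftUnique (alternatingArc S M N) := by
  rintro a b c (⟨hac, hc⟩ | ⟨hac, hc⟩) (⟨hbc, hc'⟩ | ⟨hbc, hc'⟩)
  · exact M.2.eq_of_adj_right hac hbc
  · exact absurd hc hc'
  · exact absurd hc' hc
  · exact N.2.eq_of_adj_right hac hbc

theorem not_alternatingArc_of_mem_matchingSet_diff {M N : Matching G} {u : V}
    (hu : u ∈ matchingSet S M \ matchingSet S N) (a : V) : ¬ alternatingArc S M N a u := by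
  simp only [matchingSet, Set.mem_sdiff, Set.mem_symmDiff] at hu
  rintro (⟨hau, huS⟩ | ⟨hau, huS⟩)
  · have huM : u ∈ M.1.verts := M.1.edge_vert hau.symm
    tauto
  · have huN : u ∈ N.1.verts := N.1.edge_vert hau.symm
    tauto

theorem mem_left_iff_notMem_left_of_adj (hG : G.IsBipartiteWith S T) {a b : V} (h : G.Adj a b) :
    a ∈ S ↔ b ∉ S := by
  have hST := Set.disjoint_left.1 hG.disjoint
  rcases hG.mem_of_adj h with ⟨ha, hb⟩ | ⟨ha, hb⟩
  · exact iff_of_true ha fun hb' => hST hb' hb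
  · exact iff_of_false (fun ha' => hST ha' ha) (not_not.2 hb)

theorem symmGen_alternatingArc_of_adj (hG : G.IsBipartiteWith S T) {M N : Matching G} {a b : V}
    (h : (M.unionGraph N).Adj a b) : Relation.SymmGen (alternatingArc S M N) a b := by
  by_cases hb : b ∈ S <;> rcases h with h | h <;>
    have hab := mem_left_iff_notMem_left_of_adj hG h.adj_sub
  · exact .inl (.inl ⟨h, hb⟩)
  · exact .inr (.inr ⟨h.symm, fun ha => hab.1 ha hb⟩)
  · exact .inr (.inl ⟨h.symm, hab.2 hb⟩)
  · exact .inl (.inr ⟨h, hb⟩)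

theorem injOn_componentSupp (hG : G.IsBipartiteWith S T) (M N : Matching G) :
    (matchingSet S M \ matchingSet S N).InjOn (M.componentSupp N) := by
  intro u hu v hv huv
  rw [componentSupp_eq_iff, SimpleGraph.reachable_iff_reflTransGen] at huv
  exact eq_of_reflTransGen_symmGen_of_leftUnique (leftUnique_alternatingArc S M N)
    (not_alternatingArc_of_mem_matchingSet_diff hu)
    (not_alternatingArc_of_mem_matchingSet_diff hv)
    (Relation.ReflTransGen.mono (fun _ _ => symmGen_alternatingArc_of_adj hG) _ _ huv)

end Orientation

section Mix

/-- The matching that follows `M` on the components of `M ∪ N` selected by `ω` and `N` on the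
others. -/
def mix (ω : Set V → Bool) (M N : Matching G) : Matching G where
  val :=
    { verts := mixSet (M.componentSupp N) ω M.1.verts N.1.verts
      Adj a b := if ω (M.componentSupp N a) then M.1.Adj a b else N.1.Adj a b
      adj_sub h := by
        split_ifs at h <;> exact h.adj_sub
      edge_vert h := by
        rw [mem_mixSet]
        split_ifs at h ⊢ <;> exact SimpleGraph.Subgraph.edge_vert _ h
      symm := ⟨fun a b h => by
        have hab : (M.unionGraph N).Adj a b := by
          rw [unionGraph_adj]; split_ifs at h <;> simp [h]
        rw [← componentSupp_eq_iff.2 hab.reachable]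
        split_ifs at h ⊢ <;> exact h.symm⟩ }
  property a ha := by
    rw [mem_mixSet] at ha
    dsimp only
    split_ifs at ha ⊢
    exacts [M.2 ha, N.2 ha]

variable (ω : Set V → Bool) (M N : Matching G)

theorem mix_adj {a b : V} : (mix ω M N).1.Adj a b ↔
    if ω (M.componentSupp N a) then M.1.Adj a b else N.1.Adj a b := Iff.rfl

theorem matchingSet_mix (S : Set V) : matchingSet S (mix ω M N) =
    mixSet (M.componentSupp N) ω (matchingSet S M) (matchingSet S N) := by
  ext a
  have hverts : a ∈ (mix ω M N).1.verts ↔ _ := mem_mixSet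
  simp only [matchingSet, Set.mem_symmDiff, hverts, mem_mixSet]
  split_ifs <;> rfl

theorem unionGraph_mix_mix_compl :
    (mix ω M N).unionGraph (mix ωᶜ M N) = M.unionGraph N := by
  ext a b
  simp only [unionGraph_adj, mix_adj, Pi.compl_apply]
  by_cases h : ω (M.componentSupp N a) <;> simp [h, or_comm]

theorem componentSupp_mix_mix_compl :
    (mix ω M N).componentSupp (mix ωᶜ M N) = M.componentSupp N := by
  unfold componentSupp
  rw [unionGraph_mix_mix_compl]

theorem mix_mix_mix_compl : mix ω (mix ω M N) (mix ωᶜ M N) = M := by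
  refine ext_adj fun a b => ?_
  simp only [mix_adj, componentSupp_mix_mix_compl, Pi.compl_apply]
  by_cases h : ω (M.componentSupp N a) <;> simp [h]

theorem mix_compl_mix_mix_compl : mix ωᶜ (mix ω M N) (mix ωᶜ M N) = N := by
  refine ext_adj fun a b => ?_
  simp only [mix_adj, componentSupp_mix_mix_compl, Pi.compl_apply]
  by_cases h : ω (M.componentSupp N a) <;> simp [h]

/-- The exchange of `M` and `N` on the components of `M ∪ N` not selected by `ω`. -/
def swap : Equiv.Perm (Matching G × Matching G) :=
  Function.Involutive.toPerm (fun p => (mix ω p.1 p.2, mix ωᶜ p.1 p.2)) fun p =>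
    Prod.ext (mix_mix_mix_compl ω p.1 p.2) (mix_compl_mix_mix_compl ω p.1 p.2)

theorem swap_apply (p : Matching G × Matching G) :
    swap ω p = (mix ω p.1 p.2, mix ωᶜ p.1 p.2) := rfl

theorem ncard_swap_fst_mem_disjointOccurrence_le [Finite V] {S T : Set V}
    (hG : G.IsBipartiteWith S T) {𝒜 ℬ : Set (Set V)} (h𝒜 : IsUpperSet 𝒜) (hℬ : IsUpperSet ℬ)
    (p : Matching G × Matching G) :
    {ω | matchingSet S (swap ω p).1 ∈ disjointOccurrence 𝒜 ℬ}.ncard ≤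
      {ω | matchingSet S (swap ω p).1 ∈ 𝒜 ∧ matchingSet S (swap ω p).2 ∈ ℬ}.ncard := by
  simp only [swap_apply, matchingSet_mix]
  exact ncard_mixSet_mem_disjointOccurrence_le h𝒜 hℬ (injOn_componentSupp hG p.1 p.2)
    (componentSupp_comm p.1 p.2 ▸ injOn_componentSupp hG p.2 p.1)

end Mix

end Matching

theorem ncard_mem_disjointOccurrence_mul_card_le {V : Type*} [Finite V] {G : SimpleGraph V}
    {S T : Set V} (hG : G.IsBipartiteWith S T) {𝒜 ℬ : Set (Set V)} (h𝒜 : IsUpperSet 𝒜)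
    (hℬ : IsUpperSet ℬ) :
    {M : Matching G | matchingSet S M ∈ disjointOccurrence 𝒜 ℬ}.ncard * Nat.card (Matching G) ≤
      {M : Matching G | matchingSet S M ∈ 𝒜}.ncard *
        {M : Matching G | matchingSet S M ∈ ℬ}.ncard := by
  rw [← Set.ncard_univ, ← Set.ncard_prod, ← Set.ncard_prod, Set.prod_univ]
  exact ncard_le_ncard_of_forall_perm Matching.swap
    (Matching.ncard_swap_fst_mem_disjointOccurrence_le hG h𝒜 hℬ)

theorem theorem1 {V : Type*} [Finite V] (G : SimpleGraph V) (S T : Set V)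
    (hG : G.IsBipartiteWith S T) (hST : S ∪ T = Set.univ)
    (𝒜 ℬ : Set (Set V)) (h𝒜 : IsUpperSet 𝒜) (hℬ : IsUpperSet ℬ) :
    (uniformMatching G).toOuterMeasure {M | matchingSet S M ∈ disjointOccurrence 𝒜 ℬ} ≤
      (uniformMatching G).toOuterMeasure {M | matchingSet S M ∈ 𝒜} *
        (uniformMatching G).toOuterMeasure {M | matchingSet S M ∈ ℬ} :=
  letI := Fintype.ofFinite (Matching G)
  (toOuterMeasure_uniformOfFintype_le_mul_iff _ _ _).2
    (ncard_mem_disjointOccurrence_mul_card_le hG h𝒜 hℬ)
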